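/- Let $d\ge 1$. A Lévy measure on $\mathbb R^d$ is a positive Borel measure $\nu$ with $\nu(\{0\})=0$ and $\int_{\mathbb R^d}(1\wedge\|u\|^2)\,\nu(du)<+\infty$. A random vector $X$ in $\mathbb R^d$ is self-decomposable with parameter $b\in\mathbb R^d$ and Lévy measure $\nu$ if its characteristic function is $$\mathbb E e^{i\langle\xi;X\rangle}=\exp\Big(i\langle b;\xi\rangle+\int_{\mathbb R^d}\big(e^{i\langle\xi;u\rangle}-1-i\langle\xi;u\rangle\mathbf 1_{\|u\|\le 1}\big)\nu(du)\Big),\qquad \xi\in\mathbb R^d,$$ and $\nu$ admits a polar decomposition $\nu(du)=\mathbf 1_{(0,+\infty)}(r)\,\mathbf 1_{\mathbb S^{d-1}}(x)\,\frac{k_x(r)}{r}\,dr\,\sigma(dx)$, $u=rx$, where $\sigma$ is a finite positive measure on the unit sphere $\mathbb S^{d-1}$ and $k_x(r)$ is nonnegative, nonincreasing and right-continuous in $r\in(0,+\infty)$, and measurable in $x$. Let $X$ be a centered self-decomposable random vector in $\mathbb R^d$ (that is, $\mathbb E\|X\|<+\infty$ and $\mathbb EX=0$) with Lévy measure $\nu$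 such that $$\int_{\|u\|\ge 1}\|u\|\,\nu(du)<+\infty,\qquad \nu(du)=\mathbf 1_{(0,+\infty)}(r)\,\mathbf 1_{\mathbb S^{d-1}}(x)\,\frac{k_x(r)}{r}\,dr\,\sigma(dx),$$ where $\sigma$ is a finite positive measure on $\mathbb S^{d-1}$ and $k_x(r)$ is a nonnegative function, continuous and nonincreasing in $r\in(0,+\infty)$, and continuous in $x\in\mathbb S^{d-1}$, with $$\lim_{r\to+\infty}k_x(r)=0,\qquad \lim_{r\to0^+}r^2k_x(r)=0,\qquad x\in\mathbb S^{d-1}.$$ Then, for all real-valued $f\in\mathcal C_c^\infty(\mathbb R^d)$ with $\mathbb Ef(X)=0$, $$\mathbb E f(X)^2\le\mathbb E\int_{\mathbb R^d}\big(f(X+u)-f(X)\big)^2\,\nu(du),$$ where the right-hand side is finite. -/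

import Mathlib

open MeasureTheory Filter Topology Set
open scoped ENNReal ContDiff Matrix

noncomputable section

/-- A Lévy measure on `ℝ^d`: a positive Borel measure without atom at the origin that integrates
`1 ∧ ‖u‖²`. -/
structure IsLevyMeasure {d : ℕ} (ν : Measure (EuclideanSpace ℝ (Fin d))) : Prop where
  zero_atom : ν {0} = 0
  lintegral_lt_top : ∫⁻ u, ENNReal.ofReal (min 1 (‖u‖ ^ 2)) ∂ν < ⊤

/-- The Lévy–Khintchine exponent
`i⟨b;ξ⟩ - ⟨ξ;Σξ⟩/2 + ∫ (e^{i⟨ξ;u⟩} - 1 - i⟨ξ;u⟩ 1_{‖u‖ ≤ 1}) ν(du)`. -/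
def levyExponent {d : ℕ} (b : EuclideanSpace ℝ (Fin d)) (S : Matrix (Fin d) (Fin d) ℝ)
    (ν : Measure (EuclideanSpace ℝ (Fin d))) (ξ : EuclideanSpace ℝ (Fin d)) : ℂ :=
  Complex.I * ((inner ℝ b ξ : ℝ) : ℂ)
    - (1 / 2 : ℂ) * ((inner ℝ ξ (Matrix.toEuclideanLin S ξ) : ℝ) : ℂ)
    + ∫ u, (Complex.exp (Complex.I * ((inner ℝ ξ u : ℝ) : ℂ)) - 1
        - Complex.I * (((Metric.closedBall (0 : EuclideanSpace ℝ (Fin d)) 1).indicator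
            (fun v => (inner ℝ ξ v : ℝ)) u : ℝ) : ℂ)) ∂ν

/-- The probability law `μ` on `ℝ^d` is infinitely divisible with generating triplet
`(b, S, ν)`. -/
structure IsInfinitelyDivisible {d : ℕ} (μ : Measure (EuclideanSpace ℝ (Fin d)))
    (b : EuclideanSpace ℝ (Fin d)) (S : Matrix (Fin d) (Fin d) ℝ)
    (ν : Measure (EuclideanSpace ℝ (Fin d))) : Prop where
  isProbabilityMeasure : IsProbabilityMeasure μ
  posSemidef : S.PosSemidef
  isLevyMeasure : IsLevyMeasure ν
  charFun_eq : ∀ ξ, charFun μ ξ = Complex.exp (levyExponent b S ν ξ)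

/-- The measure `1_{(0,∞)}(r) 1_{S^{d-1}}(x) (k_x(r) / r) dr σ(dx)` on `ℝ^d`, that is, the image
under `(x, r) ↦ r x` of the measure with density `k_x(r) / r` with respect to `σ(dx) dr` on
`S^{d-1} × (0,∞)`. -/
def polarMeasure {d : ℕ} (σ : Measure (Metric.sphere (0 : EuclideanSpace ℝ (Fin d)) 1))
    (k : Metric.sphere (0 : EuclideanSpace ℝ (Fin d)) 1 → ℝ → ℝ) :
    Measure (EuclideanSpace ℝ (Fin d)) :=
  ((σ.prod (volume.restrict (Ioi (0 : ℝ)))).withDensity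
      (fun p => ENNReal.ofReal (k p.1 p.2 / p.2))).map
    (fun p => p.2 • (p.1 : EuclideanSpace ℝ (Fin d)))

/-- The law `μ` is self-decomposable with drift parameter `b` and Lévy measure `ν`: it is
infinitely divisible with triplet `(b, 0, ν)`, and `ν` has a polar decomposition with radial part
`k_x(r) / r`, where `σ` is finite and `k_x(r)` is nonnegative, nonincreasing and right-continuous
in `r > 0` and measurable in `x`. -/
structure IsSelfDecomposable {d : ℕ} (μ : Measure (EuclideanSpace ℝ (Fin d)))
    (b : EuclideanSpace ℝ (Fin d)) (ν : Measure (EuclideanSpace ℝ (Fin d))) : Prop where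
  isInfinitelyDivisible : IsInfinitelyDivisible μ b 0 ν
  exists_polar : ∃ (σ : Measure (Metric.sphere (0 : EuclideanSpace ℝ (Fin d)) 1))
    (k : Metric.sphere (0 : EuclideanSpace ℝ (Fin d)) 1 → ℝ → ℝ),
    IsFiniteMeasure σ ∧
    (∀ x, ∀ r ∈ Ioi (0 : ℝ), 0 ≤ k x r) ∧
    (∀ x, AntitoneOn (k x) (Ioi 0)) ∧
    (∀ x, ∀ r ∈ Ioi (0 : ℝ), ContinuousWithinAt (k x) (Ici r) r) ∧
    (∀ r ∈ Ioi (0 : ℝ), Measurable (fun x => k x r)) ∧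
    ν = polarMeasure σ k

/-- The random vector `X` is centered: it has a finite first moment and mean zero. -/
def IsCentered {Ω : Type*} [MeasurableSpace Ω] {d : ℕ} (X : Ω → EuclideanSpace ℝ (Fin d))
    (P : Measure Ω) : Prop :=
  Integrable X P ∧ ∫ w, X w ∂P = 0

end

/-! Let `φ` be the characteristic function and `G ξ η` the inner product in `L²(ν)` of the
increments `e^{i⟨ξ;u⟩} - 1` and `e^{i⟨η;u⟩} - 1`. Without a Gaussian part, Lévy–Khintchine gives `φ
(ξ - η) = φ ξ * conj (φ η) * exp (G ξ η)` (`IsInfinitelyDivisible.charFun_sub`).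

Fourier inversion writes `f` as a superposition of characters with weight `h`. Then `E f(X)²` and
the energy are double integrals of `h ξ * conj (h η) * φ (ξ - η)`, the energy carrying an extra
factor `G ξ η`. With `H = h φ`, energy minus variance is the integral of `H ξ * conj (H η) * (G - 1)
* exp G`, and `(z - 1) e^z = ∑ (n - 1) zⁿ / n!`. The term `n = 0` is `-|∫ H|² = -(E f(X))² = 0`, the
term `n = 1` vanishes, and every later term is nonnegative because powers of a Gram kernel are
positive semidefinite (`re_integral_mul_levyGram_pow_nonneg`).

Summing under the integral is legitimate because `|φ ξ| |φ η| exp |G ξ η| ≤ 1`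
(`norm_charFun_mul_norm_charFun_mul_exp_le`). -/

open scoped ComplexConjugate

set_option linter.unusedSectionVars false
set_option linter.unusedVariables false

/-! ### Gram kernel of character increments and positivity of its powers. -/

section LevyGram

variable {E : Type*} [NormedAddCommGroup E] [InnerProductSpace ℝ E]

/-- The increment at the origin, in the direction `u`, of the character with frequency `ξ`. -/
noncomputable def charIncrement (ξ u : E) : ℂ :=
  Complex.exp (Complex.I * ((inner ℝ ξ u : ℝ) : ℂ)) - 1

theorem continuous_charIncrement : Continuous fun p : E × E => charIncrement p.1 p.2 := by
  unfold charIncrement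
  fun_prop

theorem norm_charIncrement_le_two (ξ u : E) : ‖charIncrement ξ u‖ ≤ 2 := by
  refine (norm_sub_le _ _).trans ?_
  rw [Complex.norm_exp_I_mul_ofReal]
  norm_num

/-- Merges the bounds `2` and `‖ξ‖ * ‖u‖`. A product of two such bounds is ν-integrable in `u` and
costs only one power of each frequency, which explains the polynomial moments below. -/
theorem norm_charIncrement_le (ξ u : E) :
    ‖charIncrement ξ u‖ ≤ 2 * (1 + ‖ξ‖) * min 1 ‖u‖ := by
  have h1 := norm_charIncrement_le_two ξ u
  have h2 : ‖charIncrement ξ u‖ ≤ ‖ξ‖ * ‖u‖ :=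
    (Real.norm_exp_I_mul_ofReal_sub_one_le).trans (norm_inner_le_norm ξ u)
  rcases le_total 1 ‖u‖ with hu | hu
  · rw [min_eq_left hu]
    nlinarith [norm_nonneg ξ]
  · rw [min_eq_right hu]
    nlinarith [norm_nonneg ξ, norm_nonneg u, mul_nonneg (norm_nonneg ξ) (norm_nonneg u)]

theorem min_one_mul_self_norm (u : E) : min 1 ‖u‖ * min 1 ‖u‖ = min 1 (‖u‖ ^ 2) := by
  rcases le_total 1 ‖u‖ with hu | hu
  · rw [min_eq_left hu, min_eq_left (one_le_pow₀ hu), one_mul]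
  · rw [min_eq_right hu, min_eq_right (pow_le_one₀ (norm_nonneg _) hu), sq]

theorem norm_charIncrement_mul_conj_le (ξ η u : E) :
    ‖charIncrement ξ u * conj (charIncrement η u)‖
      ≤ 4 * (1 + ‖ξ‖) * (1 + ‖η‖) * min 1 (‖u‖ ^ 2) := by
  rw [norm_mul, RCLike.norm_conj, ← min_one_mul_self_norm]
  calc _ ≤ (2 * (1 + ‖ξ‖) * min 1 ‖u‖) * (2 * (1 + ‖η‖) * min 1 ‖u‖) := by
        gcongr <;> apply norm_charIncrement_le
    _ = _ := by ring

variable [MeasurableSpace E] [BorelSpace E] [SecondCountableTopology E]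

theorem stronglyMeasurable_charIncrement_mul_conj :
    StronglyMeasurable fun q : (E × E) × E =>
      charIncrement q.1.1 q.2 * conj (charIncrement q.1.2 q.2) := by
  have h1 : Continuous fun q : (E × E) × E => charIncrement q.1.1 q.2 :=
    continuous_charIncrement.comp (f := fun q : (E × E) × E => (q.1.1, q.2)) (by fun_prop)
  have h2 : Continuous fun q : (E × E) × E => charIncrement q.1.2 q.2 :=
    continuous_charIncrement.comp (f := fun q : (E × E) × E => (q.1.2, q.2)) (by fun_prop)
  exact (h1.mul (Complex.continuous_conj.comp h2)).stronglyMeasurable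

/-- The Gram kernel of the character increments in `L²(ν)`. -/
noncomputable def levyGram (ν : Measure E) (ξ η : E) : ℂ :=
  ∫ u, charIncrement ξ u * conj (charIncrement η u) ∂ν

variable {ν : Measure E}

theorem integrable_charIncrement_mul_conj (hw : Integrable (fun u : E => min 1 (‖u‖ ^ 2)) ν)
    (ξ η : E) : Integrable (fun u => charIncrement ξ u * conj (charIncrement η u)) ν := by
  refine (hw.const_mul (4 * (1 + ‖ξ‖) * (1 + ‖η‖))).mono' ?_
    (.of_forall fun u => norm_charIncrement_mul_conj_le ξ η u)
  exact (stronglyMeasurable_charIncrement_mul_conj.comp_measurable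
    (measurable_prodMk_left (x := (ξ, η)))).aestronglyMeasurable

theorem norm_levyGram_le (hw : Integrable (fun u : E => min 1 (‖u‖ ^ 2)) ν) (ξ η : E) :
    ‖levyGram ν ξ η‖ ≤ (4 * ∫ u, min 1 (‖u‖ ^ 2) ∂ν) * ((1 + ‖ξ‖) * (1 + ‖η‖)) := by
  refine (norm_integral_le_of_norm_le (hw.const_mul (4 * (1 + ‖ξ‖) * (1 + ‖η‖)))
    (.of_forall fun u => norm_charIncrement_mul_conj_le ξ η u)).trans_eq ?_
  rw [integral_const_mul]
  ring

/-- Arithmetic–geometric mean inequality under the integral. The constant `1 / 2` matters: it is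
exactly what the decay of the characteristic function compensates. -/
theorem norm_levyGram_le_half_add (hw : Integrable (fun u : E => min 1 (‖u‖ ^ 2)) ν) (ξ η : E) :
    ‖levyGram ν ξ η‖ ≤ ((levyGram ν ξ ξ).re + (levyGram ν η η).re) / 2 := by
  have hre : ∀ ζ, (levyGram ν ζ ζ).re = ∫ u, ‖charIncrement ζ u‖ ^ 2 ∂ν := by
    intro ζ
    have := integral_re (integrable_charIncrement_mul_conj hw ζ ζ)
    simp only [Complex.mul_conj, RCLike.re_eq_complex_re, Complex.ofReal_re] at this
    simp only [levyGram, Complex.mul_conj, Complex.normSq_eq_norm_sq] at this ⊢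
    exact this.symm
  have hint : ∀ ζ, Integrable (fun u => ‖charIncrement ζ u‖ ^ 2) ν := by
    intro ζ
    refine (integrable_charIncrement_mul_conj hw ζ ζ).norm.congr (.of_forall fun u => ?_)
    simp [sq]
  rw [hre, hre, ← integral_add (hint ξ) (hint η), ← integral_div]
  refine norm_integral_le_of_norm_le (((hint ξ).add (hint η)).div_const 2) (.of_forall fun u => ?_)
  rw [norm_mul, RCLike.norm_conj]
  nlinarith [sq_nonneg (‖charIncrement ξ u‖ - ‖charIncrement η u‖)]

theorem stronglyMeasurable_levyGram [SFinite ν] :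
    StronglyMeasurable fun p : E × E => levyGram ν p.1 p.2 :=
  stronglyMeasurable_charIncrement_mul_conj.integral_prod_right

/-- A measurable function all of whose polynomial moments against `m` are finite. -/
structure HasPolyMoments (m : Measure E) (H : E → ℂ) : Prop where
  measurable : Measurable H
  integrable : ∀ N : ℕ, Integrable (fun ξ => (1 + ‖ξ‖) ^ N * ‖H ξ‖) m

variable {m : Measure E}

theorem HasPolyMoments.mul_of_norm_le {H g : E → ℂ} (hH : HasPolyMoments m H) (hg : Measurable g)
    (C : ℝ) (hC : ∀ ξ, ‖g ξ‖ ≤ C) : HasPolyMoments m fun ξ => H ξ * g ξ := by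
  refine ⟨hH.measurable.mul hg, fun N => ((hH.integrable N).mul_const C).mono' ?_
    (.of_forall fun ξ => ?_)⟩
  · have := hH.measurable
    exact (Measurable.mul (by fun_prop) (by fun_prop)).aestronglyMeasurable
  · rw [norm_mul, norm_norm, norm_mul, norm_pow, Real.norm_of_nonneg (by positivity), ← mul_assoc]
    gcongr
    exact hC ξ

theorem HasPolyMoments.integrable_fun {H : E → ℂ} (hH : HasPolyMoments m H) :
    Integrable H m :=
  (hH.integrable 0).mono' hH.measurable.aestronglyMeasurable (.of_forall fun ξ => by simp)

theorem HasPolyMoments.integrable_prod_mul_pow [SFinite m] [SFinite ν] {H : E → ℂ}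
    (hw : Integrable (fun u : E => min 1 (‖u‖ ^ 2)) ν) (hH : HasPolyMoments m H) (n : ℕ) :
    Integrable (fun q : (E × E) × E => H q.1.1 * conj (H q.1.2) * levyGram ν q.1.1 q.1.2 ^ n
      * (charIncrement q.1.1 q.2 * conj (charIncrement q.1.2 q.2))) ((m.prod m).prod ν) := by
  set C : ℝ := 4 * ∫ u, min 1 (‖u‖ ^ 2) ∂ν with hCdef
  have hC : 0 ≤ C := by positivity
  -- Of the `n + 1` powers of each frequency, `n` come from `levyGram ^ n` and one from the
  -- increment.
  have hb := ((hH.integrable (n + 1)).mul_prod (hH.integrable (n + 1))).mul_prod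
    (hw.const_mul (4 * C ^ n))
  refine hb.mono' ?_ (.of_forall fun q => ?_)
  · refine StronglyMeasurable.aestronglyMeasurable ?_
    refine StronglyMeasurable.mul ?_ stronglyMeasurable_charIncrement_mul_conj
    refine StronglyMeasurable.mul ?_
      ((stronglyMeasurable_levyGram.pow n).comp_measurable measurable_fst)
    have := hH.measurable
    have h2 : Measurable fun q : (E × E) × E => H q.1.1 * conj (H q.1.2) :=
      (by fun_prop : Measurable fun q : (E × E) × E => H q.1.1).mul
        (Complex.continuous_conj.measurable.comp
          (by fun_prop : Measurable fun q : (E × E) × E => H q.1.2))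
    exact h2.stronglyMeasurable
  · rw [norm_mul, norm_mul, norm_mul, norm_pow, RCLike.norm_conj]
    calc _ ≤ ‖H q.1.1‖ * ‖H q.1.2‖ * (C * ((1 + ‖q.1.1‖) * (1 + ‖q.1.2‖))) ^ n
          * (4 * (1 + ‖q.1.1‖) * (1 + ‖q.1.2‖) * min 1 (‖q.2‖ ^ 2)) := by
          gcongr
          · exact norm_levyGram_le hw _ _
          · exact norm_charIncrement_mul_conj_le _ _ _
      _ = _ := by
        simp only [mul_pow, pow_succ]
        clear_value C
        ring

/-- Schur product theorem in integral form. One factor of the kernel is opened as an integral over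
`u`, and its two increments are absorbed into `H`. What remains is an average over `ν` of the same
expression with one power fewer. -/
theorem HasPolyMoments.re_integral_mul_levyGram_pow_nonneg [SFinite m] [SFinite ν]
    (hw : Integrable (fun u : E => min 1 (‖u‖ ^ 2)) ν) (n : ℕ) {H : E → ℂ}
    (hH : HasPolyMoments m H) :
    0 ≤ (∫ p : E × E, H p.1 * conj (H p.2) * levyGram ν p.1 p.2 ^ n ∂(m.prod m)).re := by
  induction n generalizing H with
  | zero =>
    simp only [pow_zero, mul_one]
    rw [integral_prod_mul H fun η => conj (H η), integral_conj, Complex.mul_conj,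
      Complex.ofReal_re]
    exact Complex.normSq_nonneg _
  | succ n ih =>
    have hint := hH.integrable_prod_mul_pow hw n
    have hswap : ∫ p : E × E, H p.1 * conj (H p.2) * levyGram ν p.1 p.2 ^ (n + 1) ∂(m.prod m)
        = ∫ u, ∫ p : E × E, (H p.1 * charIncrement p.1 u) * conj (H p.2 * charIncrement p.2 u)
          * levyGram ν p.1 p.2 ^ n ∂(m.prod m) ∂ν := by
      calc _ = ∫ p : E × E, ∫ u, H p.1 * conj (H p.2) * levyGram ν p.1 p.2 ^ n
          * (charIncrement p.1 u * conj (charIncrement p.2 u)) ∂ν ∂(m.prod m) := by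
            refine integral_congr_ae (.of_forall fun p => ?_)
            simp only
            rw [integral_const_mul, pow_succ, ← mul_assoc]
            rfl
        _ = _ := by
            rw [integral_integral_swap hint]
            refine integral_congr_ae (.of_forall fun u => ?_)
            refine integral_congr_ae (.of_forall fun p => ?_)
            simp only [map_mul]
            ring
    have hint' : Integrable (fun u => ∫ p : E × E, (H p.1 * charIncrement p.1 u)
        * conj (H p.2 * charIncrement p.2 u) * levyGram ν p.1 p.2 ^ n ∂(m.prod m)) ν := by
      refine hint.integral_prod_right.congr (.of_forall fun u => ?_)
      refine integral_congr_ae (.of_forall fun p => ?_)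
      simp only [map_mul]
      ring
    rw [hswap]
    have := integral_re hint'
    simp only [RCLike.re_eq_complex_re] at this
    rw [← this]
    -- The increment is bounded by `2` uniformly in the frequency, so the modified weight keeps all
    -- its moments.
    refine integral_nonneg fun u => ih (H := fun ξ => H ξ * charIncrement ξ u) ?_
    refine hH.mul_of_norm_le ?_ 2 fun ξ => norm_charIncrement_le_two ξ u
    exact continuous_charIncrement.measurable.comp measurable_prodMk_right

/-- The series `∑ (n - 1) zⁿ / n!`. -/
theorem hasSum_sub_one_div_factorial_mul_pow (z : ℂ) :
    HasSum (fun n : ℕ => (((n - 1) / n.factorial : ℝ) : ℂ) * z ^ n)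
      (z * Complex.exp z - Complex.exp z) := by
  have h0 : HasSum (fun n : ℕ => z ^ n / (n.factorial : ℂ)) (Complex.exp z) := by
    rw [Complex.exp_eq_exp_ℂ]
    exact NormedSpace.expSeries_div_hasSum_exp z
  have h1 : HasSum (fun n : ℕ => (n : ℂ) * (z ^ n / (n.factorial : ℂ))) (z * Complex.exp z) := by
    -- The factor `n` kills the zeroth term; shifting the index turns the rest into `z` times the
    -- exponential series.
    rw [← hasSum_nat_add_iff' 1]
    simp only [Finset.range_one, Finset.sum_singleton, Nat.cast_zero, zero_mul, sub_zero]
    refine (h0.mul_left z).congr_fun ?_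
    intro n
    have : ((n : ℂ) + 1) ≠ 0 := by exact_mod_cast n.succ_ne_zero
    have h' : (n.factorial : ℂ) ≠ 0 := by exact_mod_cast n.factorial_ne_zero
    rw [Nat.factorial_succ]
    push_cast
    field_simp
    ring
  refine (h1.sub h0).congr_fun fun n => ?_
  push_cast
  ring

/-- Majorant of the previous series, since `|n - 1| ≤ n + 1`. -/
theorem hasSum_add_one_div_factorial_mul_pow (x : ℝ) :
    HasSum (fun n : ℕ => ((n + 1) / n.factorial : ℝ) * x ^ n)
      (x * Real.exp x + Real.exp x) := by
  have h0 : HasSum (fun n : ℕ => x ^ n / (n.factorial : ℝ)) (Real.exp x) := by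
    rw [Real.exp_eq_exp_ℝ]
    exact NormedSpace.expSeries_div_hasSum_exp x
  have h1 : HasSum (fun n : ℕ => (n : ℝ) * (x ^ n / (n.factorial : ℝ))) (x * Real.exp x) := by
    rw [← hasSum_nat_add_iff' 1]
    simp only [Finset.range_one, Finset.sum_singleton, Nat.cast_zero, zero_mul, sub_zero]
    refine (h0.mul_left x).congr_fun ?_
    intro n
    have : ((n : ℝ) + 1) ≠ 0 := by exact_mod_cast n.succ_ne_zero
    have h' : (n.factorial : ℝ) ≠ 0 := by exact_mod_cast n.factorial_ne_zero
    rw [Nat.factorial_succ]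
    push_cast
    field_simp
    ring
  refine (h1.add h0).congr_fun fun n => ?_
  ring

end LevyGram

/-! ### Domination and positivity of the series for energy minus variance. -/

section Spectral

variable {E : Type*} [NormedAddCommGroup E] [InnerProductSpace ℝ E] [MeasurableSpace E]
  [BorelSpace E] [SecondCountableTopology E] {ν m μ : Measure E}

/-- Take `η = ξ` in the factorization: the left side is `charFun μ 0 = 1`. -/
theorem norm_charFun_eq_exp_levyGram [IsProbabilityMeasure μ]
    (hφ : ∀ ξ η, charFun μ (ξ - η)
      = charFun μ ξ * conj (charFun μ η) * Complex.exp (levyGram ν ξ η)) (ξ : E) :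
    ‖charFun μ ξ‖ = Real.exp (-(levyGram ν ξ ξ).re / 2) := by
  have h := congrArg norm (hφ ξ ξ)
  rw [sub_self, charFun_zero, norm_mul, norm_mul, RCLike.norm_conj, Complex.norm_exp] at h
  simp only [probReal_univ, Complex.ofReal_one, norm_one] at h
  have h2 : ‖charFun μ ξ‖ ^ 2 = Real.exp (-(levyGram ν ξ ξ).re / 2) ^ 2 := by
    rw [← Real.exp_nat_mul, sq]
    have h3 := Real.exp_pos (levyGram ν ξ ξ).re
    have h4 : Real.exp (-(levyGram ν ξ ξ).re) * Real.exp (levyGram ν ξ ξ).re = 1 := by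
      rw [← Real.exp_add]
      simp
    rw [show ((2 : ℕ) : ℝ) * (-(levyGram ν ξ ξ).re / 2) = -(levyGram ν ξ ξ).re by push_cast; ring]
    exact mul_right_cancel₀ h3.ne' (h.symm.trans h4.symm)
  exact (pow_left_inj₀ (norm_nonneg _) (Real.exp_pos _).le two_ne_zero).1 h2

theorem norm_charFun_mul_norm_charFun_mul_exp_le [IsProbabilityMeasure μ]
    (hw : Integrable (fun u : E => min 1 (‖u‖ ^ 2)) ν)
    (hφ : ∀ ξ η, charFun μ (ξ - η)
      = charFun μ ξ * conj (charFun μ η) * Complex.exp (levyGram ν ξ η)) (ξ η : E) :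
    ‖charFun μ ξ‖ * ‖charFun μ η‖ * Real.exp ‖levyGram ν ξ η‖ ≤ 1 := by
  rw [norm_charFun_eq_exp_levyGram hφ, norm_charFun_eq_exp_levyGram hφ, ← Real.exp_add,
    ← Real.exp_add, Real.exp_le_one_iff]
  linarith [norm_levyGram_le_half_add hw ξ η]

/-- The common majorant for integrands of size `‖h ξ‖ * ‖h η‖ * (‖levyGram ν ξ η‖ + 1)`. -/
theorem HasPolyMoments.integrable_norm_mul_norm_mul [SFinite m] {h : E → ℂ}
    (hh : HasPolyMoments m h) (C : ℝ) :
    Integrable (fun p : E × E => ‖h p.1‖ * ‖h p.2‖ * (C * ((1 + ‖p.1‖) * (1 + ‖p.2‖)) + 1))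
      (m.prod m) := by
  have h1 := ((hh.integrable 1).mul_prod (hh.integrable 1)).const_mul C
  have h0 := (hh.integrable 0).mul_prod (hh.integrable 0)
  refine (h1.add h0).congr (.of_forall fun p => ?_)
  simp only [Pi.add_apply, pow_one, pow_zero]
  ring

theorem HasPolyMoments.measurable_mul_conj {h : E → ℂ} (hh : HasPolyMoments m h) :
    Measurable fun p : E × E => h p.1 * conj (h p.2) :=
  (hh.measurable.comp measurable_fst).mul
    (Complex.continuous_conj.measurable.comp (hh.measurable.comp measurable_snd))

/-- Expand `(z - 1) e^z` at `z = levyGram ν ξ η`, integrate term by term and check the sign of each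
term. The hypothesis `h0` removes the only negative coefficient. -/
theorem HasPolyMoments.re_integral_charFun_mul_levyGram_sub_one_nonneg [IsProbabilityMeasure μ]
    [SFinite m] [SFinite ν] (hw : Integrable (fun u : E => min 1 (‖u‖ ^ 2)) ν)
    (hφ : ∀ ξ η, charFun μ (ξ - η)
      = charFun μ ξ * conj (charFun μ η) * Complex.exp (levyGram ν ξ η))
    {h : E → ℂ} (hh : HasPolyMoments m h) (h0 : ∫ ξ, h ξ * charFun μ ξ ∂m = 0) :
    0 ≤ (∫ p : E × E, h p.1 * conj (h p.2) * (charFun μ (p.1 - p.2)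
      * (levyGram ν p.1 p.2 - 1)) ∂(m.prod m)).re := by
  set H : E → ℂ := fun ξ => h ξ * charFun μ ξ with hHdef
  have hH : HasPolyMoments m H :=
    hh.mul_of_norm_le stronglyMeasurable_charFun.measurable 1 fun ξ => norm_charFun_le_one ξ
  set C : ℝ := 4 * ∫ u, min 1 (‖u‖ ^ 2) ∂ν with hC
  have hHn : ∀ ξ η, ‖H ξ * conj (H η)‖
      = ‖h ξ‖ * ‖h η‖ * (‖charFun μ ξ‖ * ‖charFun μ η‖) := by
    intro ξ η
    simp only [hHdef, norm_mul, RCLike.norm_conj]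
    ring
  have hsum : HasSum (fun n : ℕ => ∫ p : E × E, H p.1 * conj (H p.2)
      * ((((n - 1) / n.factorial : ℝ) : ℂ) * levyGram ν p.1 p.2 ^ n) ∂(m.prod m))
      (∫ p : E × E, H p.1 * conj (H p.2) * (levyGram ν p.1 p.2 * Complex.exp (levyGram ν p.1 p.2)
        - Complex.exp (levyGram ν p.1 p.2)) ∂(m.prod m)) := by
    have hsb : ∀ p : E × E, HasSum (fun n : ℕ => ‖H p.1 * conj (H p.2)‖
        * (((n + 1) / n.factorial : ℝ) * ‖levyGram ν p.1 p.2‖ ^ n))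
        (‖H p.1 * conj (H p.2)‖ * (‖levyGram ν p.1 p.2‖ * Real.exp ‖levyGram ν p.1 p.2‖
          + Real.exp ‖levyGram ν p.1 p.2‖)) := fun p =>
      (hasSum_add_one_div_factorial_mul_pow _).mul_left _
    refine hasSum_integral_of_dominated_convergence
      (fun (n : ℕ) (p : E × E) => ‖H p.1 * conj (H p.2)‖
        * (((n + 1) / n.factorial : ℝ) * ‖levyGram ν p.1 p.2‖ ^ n)) ?_ ?_ ?_ ?_ ?_
    · intro n
      exact hH.measurable_mul_conj.aestronglyMeasurable.mul
        ((stronglyMeasurable_levyGram.pow n).const_mul _).aestronglyMeasurable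
    · refine fun n => .of_forall fun p => ?_
      rw [norm_mul, norm_mul ((_ : ℝ) : ℂ), norm_pow, Complex.norm_real, norm_div,
        Real.norm_of_nonneg (Nat.cast_nonneg n.factorial)]
      gcongr
      refine (norm_sub_le _ _).trans ?_
      simp
    · exact .of_forall fun p => (hsb p).summable
    · simp only [fun p => (hsb p).tsum_eq]
      refine (hh.integrable_norm_mul_norm_mul C).mono' ?_ (.of_forall fun p => ?_)
      · have hG := (stronglyMeasurable_levyGram (ν := ν)).norm.measurable
        exact (hH.measurable_mul_conj.norm.mul
          ((hG.mul (Real.measurable_exp.comp hG)).add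
            (Real.measurable_exp.comp hG))).aestronglyMeasurable
      · rw [Real.norm_of_nonneg (by positivity), hHn]
        -- Grouping the exponential with the two characteristic functions makes its growth
        -- disappear; only the linear factor survives.
        calc _ = ‖h p.1‖ * ‖h p.2‖ * ((‖charFun μ p.1‖ * ‖charFun μ p.2‖
              * Real.exp ‖levyGram ν p.1 p.2‖) * (‖levyGram ν p.1 p.2‖ + 1)) := by ring
          _ ≤ ‖h p.1‖ * ‖h p.2‖ * (1 * (C * ((1 + ‖p.1‖) * (1 + ‖p.2‖)) + 1)) := by
            gcongr
            · exact norm_charFun_mul_norm_charFun_mul_exp_le hw hφ _ _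
            · exact norm_levyGram_le hw _ _
          _ = _ := by rw [one_mul]
    · exact .of_forall fun p => (hasSum_sub_one_div_factorial_mul_pow _).mul_left _
  have hcongr : ∫ p : E × E, h p.1 * conj (h p.2) * (charFun μ (p.1 - p.2)
      * (levyGram ν p.1 p.2 - 1)) ∂(m.prod m)
      = ∫ p : E × E, H p.1 * conj (H p.2) * (levyGram ν p.1 p.2 * Complex.exp (levyGram ν p.1 p.2)
        - Complex.exp (levyGram ν p.1 p.2)) ∂(m.prod m) := by
    refine integral_congr_ae (.of_forall fun p => ?_)
    simp only [hHdef, hφ p.1 p.2, map_mul]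
    ring
  rw [hcongr]
  refine (Complex.hasSum_re hsum).nonneg fun n => ?_
  have hterm : ∫ p : E × E, H p.1 * conj (H p.2)
      * ((((n - 1) / n.factorial : ℝ) : ℂ) * levyGram ν p.1 p.2 ^ n) ∂(m.prod m)
      = (((n - 1) / n.factorial : ℝ) : ℂ)
        * ∫ p : E × E, H p.1 * conj (H p.2) * levyGram ν p.1 p.2 ^ n ∂(m.prod m) := by
    rw [← integral_const_mul]
    refine integral_congr_ae (.of_forall fun p => ?_)
    simp only
    ring
  rw [hterm, Complex.re_ofReal_mul]
  -- The coefficient is `-1` at index `0`, where the integral is `|∫ H|² = 0`, and `n / (n + 1)! ≥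
  -- 0` at index `n + 1`.
  rcases n with _ | n
  · simp only [pow_zero, mul_one]
    rw [integral_prod_mul H fun η => conj (H η), h0]
    simp
  · refine mul_nonneg ?_ (hH.re_integral_mul_levyGram_pow_nonneg hw _)
    push_cast
    rw [add_sub_cancel_right]
    positivity

end Spectral

/-! ### Variance and energy as double integrals over frequencies. -/

section CharacterTransform

variable {E : Type*} [NormedAddCommGroup E] [InnerProductSpace ℝ E] [MeasurableSpace E]
  [BorelSpace E] [SecondCountableTopology E] {ν m μ : Measure E}
  {h : E → ℂ} {f : E → ℝ}

theorem exp_inner_sub_eq_mul_conj (ξ η x : E) :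
    Complex.exp (((inner ℝ x (ξ - η) : ℝ) : ℂ) * Complex.I)
      = Complex.exp (((inner ℝ x ξ : ℝ) : ℂ) * Complex.I)
        * conj (Complex.exp (((inner ℝ x η : ℝ) : ℂ) * Complex.I)) := by
  rw [← Complex.exp_conj, ← Complex.exp_add, inner_sub_right]
  congr 1
  simp only [map_mul, Complex.conj_ofReal, Complex.conj_I]
  push_cast
  ring

theorem HasPolyMoments.integrable_mul_exp (hh : HasPolyMoments m h) (x : E) :
    Integrable (fun ξ => h ξ * Complex.exp (((inner ℝ x ξ : ℝ) : ℂ) * Complex.I)) m := by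
  refine hh.integrable_fun.norm.mono' ?_ (.of_forall fun ξ => ?_)
  · exact (hh.measurable.mul (by fun_prop)).aestronglyMeasurable
  · rw [norm_mul, Complex.norm_exp_ofReal_mul_I, mul_one]

/-- The square of a real function with an integral representation by characters. -/
theorem ofReal_sq_eq_integral_prod [SFinite m] {g : E → ℂ} {r : ℝ} (hr : (r : ℂ) = ∫ ξ, g ξ ∂m) :
    ((r ^ 2 : ℝ) : ℂ) = ∫ p : E × E, g p.1 * conj (g p.2) ∂(m.prod m) := by
  rw [integral_prod_mul g fun η => conj (g η), integral_conj, ← hr, Complex.conj_ofReal]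
  push_cast
  ring

theorem HasPolyMoments.integral_eq [SFinite m] [IsProbabilityMeasure μ] (hh : HasPolyMoments m h)
    (hf : ∀ x, (f x : ℂ) = ∫ ξ, h ξ * Complex.exp (((inner ℝ x ξ : ℝ) : ℂ) * Complex.I) ∂m) :
    ((∫ x, f x ∂μ : ℝ) : ℂ) = ∫ ξ, h ξ * charFun μ ξ ∂m := by
  rw [← integral_complex_ofReal]
  simp only [hf]
  rw [integral_integral_swap]
  · refine integral_congr_ae (.of_forall fun ξ => ?_)
    simp only
    rw [integral_const_mul, charFun_apply]
  · refine (((integrable_const (1 : ℝ)).mul_prod hh.integrable_fun.norm : Integrable _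
      (μ.prod m))).mono' ?_ (.of_forall fun q => ?_)
    · exact ((hh.measurable.comp measurable_snd).mul (by fun_prop)).aestronglyMeasurable
    · rw [Function.uncurry, norm_mul, Complex.norm_exp_ofReal_mul_I, mul_one, one_mul]

theorem HasPolyMoments.integrable_mul_conj [SFinite m] (hh : HasPolyMoments m h) :
    Integrable (fun p : E × E => h p.1 * conj (h p.2)) (m.prod m) := by
  refine (hh.integrable_fun.norm.mul_prod hh.integrable_fun.norm).mono'
    hh.measurable_mul_conj.aestronglyMeasurable (.of_forall fun p => ?_)
  rw [norm_mul, RCLike.norm_conj]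

theorem HasPolyMoments.integral_sq_eq [SFinite m] [IsProbabilityMeasure μ]
    (hh : HasPolyMoments m h)
    (hf : ∀ x, (f x : ℂ) = ∫ ξ, h ξ * Complex.exp (((inner ℝ x ξ : ℝ) : ℂ) * Complex.I) ∂m) :
    ((∫ x, f x ^ 2 ∂μ : ℝ) : ℂ)
      = ∫ p : E × E, h p.1 * conj (h p.2) * charFun μ (p.1 - p.2) ∂(m.prod m) := by
  have hsq : ∀ x, ((f x ^ 2 : ℝ) : ℂ) = ∫ p : E × E, h p.1 * conj (h p.2)
      * Complex.exp (((inner ℝ x (p.1 - p.2) : ℝ) : ℂ) * Complex.I) ∂(m.prod m) := by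
    intro x
    rw [ofReal_sq_eq_integral_prod (hf x)]
    refine integral_congr_ae (.of_forall fun p => ?_)
    simp only [exp_inner_sub_eq_mul_conj, map_mul]
    ring
  rw [← integral_complex_ofReal]
  simp only [hsq]
  rw [integral_integral_swap]
  · refine integral_congr_ae (.of_forall fun p => ?_)
    simp only
    rw [integral_const_mul, charFun_apply]
  · refine (((integrable_const (1 : ℝ)).mul_prod hh.integrable_mul_conj.norm : Integrable _
      (μ.prod (m.prod m)))).mono' ?_ (.of_forall fun q => ?_)
    · exact ((hh.measurable_mul_conj.comp measurable_snd).mul (by fun_prop)).aestronglyMeasurable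
    · rw [Function.uncurry, norm_mul, Complex.norm_exp_ofReal_mul_I, mul_one, one_mul]

theorem HasPolyMoments.ofReal_sub_eq (hh : HasPolyMoments m h)
    (hf : ∀ x, (f x : ℂ) = ∫ ξ, h ξ * Complex.exp (((inner ℝ x ξ : ℝ) : ℂ) * Complex.I) ∂m)
    (x u : E) :
    ((f (x + u) - f x : ℝ) : ℂ) = ∫ ξ, h ξ * Complex.exp (((inner ℝ x ξ : ℝ) : ℂ) * Complex.I)
      * charIncrement ξ u ∂m := by
  push_cast
  rw [hf, hf, ← integral_sub (hh.integrable_mul_exp _) (hh.integrable_mul_exp _)]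
  refine integral_congr_ae (.of_forall fun ξ => ?_)
  simp only [charIncrement]
  rw [inner_add_left, real_inner_comm ξ u, Complex.ofReal_add, add_mul, Complex.exp_add,
    mul_comm Complex.I]
  ring

theorem HasPolyMoments.ofReal_sub_sq_eq [SFinite m] (hh : HasPolyMoments m h)
    (hf : ∀ x, (f x : ℂ) = ∫ ξ, h ξ * Complex.exp (((inner ℝ x ξ : ℝ) : ℂ) * Complex.I) ∂m)
    (x u : E) :
    (((f (x + u) - f x) ^ 2 : ℝ) : ℂ) = ∫ p : E × E, h p.1 * conj (h p.2)
      * (Complex.exp (((inner ℝ x (p.1 - p.2) : ℝ) : ℂ) * Complex.I)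
        * (charIncrement p.1 u * conj (charIncrement p.2 u))) ∂(m.prod m) := by
  rw [ofReal_sq_eq_integral_prod (hh.ofReal_sub_eq hf x u)]
  refine integral_congr_ae (.of_forall fun p => ?_)
  simp only [exp_inner_sub_eq_mul_conj, map_mul]
  ring

/-- The bound is uniform in `x`, so the integrand of the energy is integrable against any
probability measure times `ν`. -/
theorem HasPolyMoments.sub_sq_le (hh : HasPolyMoments m h)
    (hf : ∀ x, (f x : ℂ) = ∫ ξ, h ξ * Complex.exp (((inner ℝ x ξ : ℝ) : ℂ) * Complex.I) ∂m)
    (x u : E) :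
    (f (x + u) - f x) ^ 2
      ≤ (2 * ∫ ξ, (1 + ‖ξ‖) * ‖h ξ‖ ∂m) ^ 2 * min 1 (‖u‖ ^ 2) := by
  have hi := hh.integrable 1
  simp only [pow_one] at hi
  have h1 : |f (x + u) - f x| ≤ (2 * ∫ ξ, (1 + ‖ξ‖) * ‖h ξ‖ ∂m) * min 1 ‖u‖ := by
    rw [← Real.norm_eq_abs, ← Complex.norm_real, hh.ofReal_sub_eq hf x u]
    refine (norm_integral_le_of_norm_le (hi.mul_const (2 * min 1 ‖u‖))
      (.of_forall fun ξ => ?_)).trans_eq ?_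
    · rw [norm_mul, norm_mul, Complex.norm_exp_ofReal_mul_I, mul_one]
      calc _ ≤ ‖h ξ‖ * (2 * (1 + ‖ξ‖) * min 1 ‖u‖) := by
            gcongr
            exact norm_charIncrement_le ξ u
        _ = _ := by ring
    · rw [integral_mul_const]
      ring
  calc _ = |f (x + u) - f x| ^ 2 := (sq_abs _).symm
    _ ≤ ((2 * ∫ ξ, (1 + ‖ξ‖) * ‖h ξ‖ ∂m) * min 1 ‖u‖) ^ 2 := by gcongr
    _ = _ := by rw [mul_pow, sq (min 1 ‖u‖), min_one_mul_self_norm]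

theorem HasPolyMoments.integrable_sub_sq (hh : HasPolyMoments m h) (hfm : Measurable f)
    (hw : Integrable (fun u : E => min 1 (‖u‖ ^ 2)) ν)
    (hf : ∀ x, (f x : ℂ) = ∫ ξ, h ξ * Complex.exp (((inner ℝ x ξ : ℝ) : ℂ) * Complex.I) ∂m)
    (x : E) : Integrable (fun u => (f (x + u) - f x) ^ 2) ν := by
  refine (hw.const_mul ((2 * ∫ ξ, (1 + ‖ξ‖) * ‖h ξ‖ ∂m) ^ 2)).mono' ?_ (.of_forall fun u => ?_)
  · exact (by fun_prop : Measurable fun u => (f (x + u) - f x) ^ 2).aestronglyMeasurable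
  · rw [Real.norm_of_nonneg (sq_nonneg _)]
    exact hh.sub_sq_le hf x u

theorem HasPolyMoments.integrable_prod_sub_sq [SFinite ν] [IsProbabilityMeasure μ]
    (hh : HasPolyMoments m h) (hfm : Measurable f)
    (hw : Integrable (fun u : E => min 1 (‖u‖ ^ 2)) ν)
    (hf : ∀ x, (f x : ℂ) = ∫ ξ, h ξ * Complex.exp (((inner ℝ x ξ : ℝ) : ℂ) * Complex.I) ∂m) :
    Integrable (fun q : E × E => (f (q.1 + q.2) - f q.1) ^ 2) (μ.prod ν) := by
  refine ((integrable_const ((2 * ∫ ξ, (1 + ‖ξ‖) * ‖h ξ‖ ∂m) ^ 2)).mul_prod hw : Integrable _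
    (μ.prod ν)).mono' ?_ (.of_forall fun q => ?_)
  · exact (by fun_prop : Measurable fun q : E × E =>
      (f (q.1 + q.2) - f q.1) ^ 2).aestronglyMeasurable
  · rw [Real.norm_of_nonneg (sq_nonneg _)]
    exact hh.sub_sq_le hf q.1 q.2

theorem HasPolyMoments.integrable_prod_exp_mul_charIncrement [SFinite m] [SFinite ν]
    [IsProbabilityMeasure μ] (hh : HasPolyMoments m h)
    (hw : Integrable (fun u : E => min 1 (‖u‖ ^ 2)) ν) :
    Integrable (fun q : (E × E) × E × E => h q.2.1 * conj (h q.2.2)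
      * (Complex.exp (((inner ℝ q.1.1 (q.2.1 - q.2.2) : ℝ) : ℂ) * Complex.I)
        * (charIncrement q.2.1 q.1.2 * conj (charIncrement q.2.2 q.1.2))))
      ((μ.prod ν).prod (m.prod m)) := by
  have hexp : Measurable fun q : (E × E) × E × E =>
      Complex.exp (((inner ℝ q.1.1 (q.2.1 - q.2.2) : ℝ) : ℂ) * Complex.I) := by
    have hin : Measurable fun q : (E × E) × E × E => (inner ℝ q.1.1 (q.2.1 - q.2.2) : ℝ) :=
      Measurable.inner (by fun_prop) (by fun_prop)
    exact Complex.measurable_exp.comp ((Complex.measurable_ofReal.comp hin).mul_const _)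
  have hincr : Measurable fun q : (E × E) × E × E =>
      charIncrement q.2.1 q.1.2 * conj (charIncrement q.2.2 q.1.2) := by
    have hp : Measurable fun q : (E × E) × E × E => (q.2, q.1.2) :=
      measurable_snd.prodMk (measurable_snd.comp measurable_fst)
    have hc := (stronglyMeasurable_charIncrement_mul_conj (E := E)).measurable
    have hcp := hc.comp hp
    simpa only [Function.comp_def] using hcp
  have hmeas : Measurable fun q : (E × E) × E × E => h q.2.1 * conj (h q.2.2)
      * (Complex.exp (((inner ℝ q.1.1 (q.2.1 - q.2.2) : ℝ) : ℂ) * Complex.I)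
        * (charIncrement q.2.1 q.1.2 * conj (charIncrement q.2.2 q.1.2))) :=
    Measurable.mul (f := fun q : (E × E) × E × E => h q.2.1 * conj (h q.2.2))
      (hh.measurable_mul_conj.comp measurable_snd) (hexp.mul hincr)
  have hb1 : Integrable (fun q : E × E => 1 * min 1 (‖q.2‖ ^ 2)) (μ.prod ν) :=
    (integrable_const (1 : ℝ)).mul_prod hw
  have hb : Integrable (fun q : (E × E) × E × E => 1 * min 1 (‖q.1.2‖ ^ 2)
      * (‖h q.2.1‖ * ‖h q.2.2‖ * (4 * ((1 + ‖q.2.1‖) * (1 + ‖q.2.2‖)) + 1)))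
      ((μ.prod ν).prod (m.prod m)) := hb1.mul_prod (hh.integrable_norm_mul_norm_mul 4)
  refine hb.mono' hmeas.aestronglyMeasurable (.of_forall fun q => ?_)
  · rw [norm_mul, norm_mul (Complex.exp _), Complex.norm_exp_ofReal_mul_I,
      one_mul, one_mul, norm_mul (h q.2.1), RCLike.norm_conj]
    have h1 := norm_charIncrement_mul_conj_le q.2.1 q.2.2 q.1.2
    have h2 : 0 ≤ min 1 (‖q.1.2‖ ^ 2) := by positivity
    calc _ ≤ ‖h q.2.1‖ * ‖h q.2.2‖
          * (4 * (1 + ‖q.2.1‖) * (1 + ‖q.2.2‖) * min 1 (‖q.1.2‖ ^ 2)) := by gcongr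
      -- The superfluous `+ 1` only brings the bound to the form of `integrable_norm_mul_norm_mul`.
      _ ≤ ‖h q.2.1‖ * ‖h q.2.2‖
          * ((4 * ((1 + ‖q.2.1‖) * (1 + ‖q.2.2‖)) + 1) * min 1 (‖q.1.2‖ ^ 2)) := by
        gcongr
        linarith
      _ = _ := by ring

/-- After Fubini, the variables `x` and `u` separate: the first yields `charFun μ (ξ - η)`, the
second `levyGram ν ξ η`. -/
theorem HasPolyMoments.integral_integral_sub_sq_eq [SFinite m] [SFinite ν]
    [IsProbabilityMeasure μ] (hh : HasPolyMoments m h) (hfm : Measurable f)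
    (hw : Integrable (fun u : E => min 1 (‖u‖ ^ 2)) ν)
    (hf : ∀ x, (f x : ℂ) = ∫ ξ, h ξ * Complex.exp (((inner ℝ x ξ : ℝ) : ℂ) * Complex.I) ∂m) :
    ((∫ x, ∫ u, (f (x + u) - f x) ^ 2 ∂ν ∂μ : ℝ) : ℂ)
      = ∫ p : E × E, h p.1 * conj (h p.2) * (charFun μ (p.1 - p.2) * levyGram ν p.1 p.2)
        ∂(m.prod m) := by
  rw [← integral_prod _ (hh.integrable_prod_sub_sq (μ := μ) hfm hw hf), ← integral_complex_ofReal]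
  simp only [hh.ofReal_sub_sq_eq hf]
  rw [integral_integral_swap]
  · refine integral_congr_ae (.of_forall fun p => ?_)
    simp only
    rw [integral_const_mul, charFun_apply, levyGram]
    congr 1
    exact integral_prod_mul
      (fun x => Complex.exp (((inner ℝ x (p.1 - p.2) : ℝ) : ℂ) * Complex.I))
      (fun u => charIncrement p.1 u * conj (charIncrement p.2 u))
  · exact hh.integrable_prod_exp_mul_charIncrement hw

/-- The Poincaré inequality for the superposition of characters `f`. -/
theorem HasPolyMoments.integral_sq_le [SFinite m] [SFinite ν] [IsProbabilityMeasure μ]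
    (hh : HasPolyMoments m h) (hfm : Measurable f)
    (hw : Integrable (fun u : E => min 1 (‖u‖ ^ 2)) ν)
    (hφ : ∀ ξ η, charFun μ (ξ - η)
      = charFun μ ξ * conj (charFun μ η) * Complex.exp (levyGram ν ξ η))
    (hf : ∀ x, (f x : ℂ) = ∫ ξ, h ξ * Complex.exp (((inner ℝ x ξ : ℝ) : ℂ) * Complex.I) ∂m)
    (hf0 : ∫ x, f x ∂μ = 0) :
    ∫ x, f x ^ 2 ∂μ ≤ ∫ x, ∫ u, (f (x + u) - f x) ^ 2 ∂ν ∂μ := by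
  have h0 : ∫ ξ, h ξ * charFun μ ξ ∂m = 0 := by
    rw [← hh.integral_eq hf, hf0, Complex.ofReal_zero]
  have hpos := hh.re_integral_charFun_mul_levyGram_sub_one_nonneg hw hφ h0
  have hmeas : Measurable fun p : E × E => charFun μ (p.1 - p.2) :=
    stronglyMeasurable_charFun.measurable.comp (by fun_prop)
  have hi0 : Integrable (fun p : E × E => h p.1 * conj (h p.2) * charFun μ (p.1 - p.2))
      (m.prod m) := by
    refine hh.integrable_mul_conj.norm.mono'
      (hh.measurable_mul_conj.mul hmeas).aestronglyMeasurable (.of_forall fun p => ?_)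
    rw [norm_mul]
    exact mul_le_of_le_one_right (norm_nonneg _) (norm_charFun_le_one _)
  have hi1 : Integrable (fun p : E × E => h p.1 * conj (h p.2)
      * (charFun μ (p.1 - p.2) * levyGram ν p.1 p.2)) (m.prod m) := by
    refine (hh.integrable_norm_mul_norm_mul (4 * ∫ u, min 1 (‖u‖ ^ 2) ∂ν)).mono'
      (hh.measurable_mul_conj.mul
        (hmeas.mul stronglyMeasurable_levyGram.measurable)).aestronglyMeasurable
      (.of_forall fun p => ?_)
    rw [norm_mul, norm_mul (h p.1), RCLike.norm_conj, norm_mul]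
    gcongr
    have h1 := norm_levyGram_le hw p.1 p.2
    have h2 := norm_charFun_le_one (μ := μ) (p.1 - p.2)
    nlinarith [norm_nonneg (levyGram ν p.1 p.2)]
  have hsplit : ∫ p : E × E, h p.1 * conj (h p.2) * (charFun μ (p.1 - p.2)
      * (levyGram ν p.1 p.2 - 1)) ∂(m.prod m)
      = ((∫ x, ∫ u, (f (x + u) - f x) ^ 2 ∂ν ∂μ - ∫ x, f x ^ 2 ∂μ : ℝ) : ℂ) := by
    rw [Complex.ofReal_sub, hh.integral_integral_sub_sq_eq hfm hw hf, hh.integral_sq_eq hf,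
      ← integral_sub hi1 hi0]
    refine integral_congr_ae (.of_forall fun p => ?_)
    simp only
    ring
  rw [hsplit, Complex.ofReal_re] at hpos
  linarith

end CharacterTransform

/-! ### Factorization of the characteristic function from the Lévy–Khintchine formula. -/

section LevyKhintchine

theorem norm_exp_I_mul_ofReal_sub_one_sub_le (t : ℝ) :
    ‖Complex.exp (Complex.I * t) - 1 - Complex.I * t‖ ≤ 3 * t ^ 2 := by
  have hn : ‖Complex.I * (t : ℂ)‖ = |t| := by simp
  rcases le_total |t| 1 with ht | ht
  · refine (Complex.norm_exp_sub_one_sub_id_le (by rwa [hn])).trans ?_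
    rw [hn, sq_abs]
    nlinarith [sq_nonneg t]
  -- For `|t| ≥ 1` the trivial bound `2 + |t|` is at most `3 * t ^ 2`; this fixes the constant.
  · refine (norm_sub_le _ _).trans ?_
    have h1 : ‖Complex.exp (Complex.I * t) - 1‖ ≤ 2 := by
      refine (norm_sub_le _ _).trans ?_
      rw [Complex.norm_exp_I_mul_ofReal]
      norm_num
    rw [hn, ← sq_abs]
    nlinarith

variable {d : ℕ} {ν : Measure (EuclideanSpace ℝ (Fin d))}

theorem IsLevyMeasure.integrable_min_one_norm_sq (hν : IsLevyMeasure ν) :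
    Integrable (fun u : EuclideanSpace ℝ (Fin d) => min 1 (‖u‖ ^ 2)) ν := by
  refine ⟨(by fun_prop : Measurable fun u : EuclideanSpace ℝ (Fin d) =>
    min 1 (‖u‖ ^ 2)).aestronglyMeasurable, ?_⟩
  rw [hasFiniteIntegral_iff_ofReal (.of_forall fun u => by positivity)]
  exact hν.lintegral_lt_top

/-- The compensated character in the Lévy–Khintchine formula. -/
noncomputable def compensatedChar (ξ u : EuclideanSpace ℝ (Fin d)) : ℂ :=
  Complex.exp (Complex.I * ((inner ℝ ξ u : ℝ) : ℂ)) - 1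
    - Complex.I * (((Metric.closedBall (0 : EuclideanSpace ℝ (Fin d)) 1).indicator
        (fun v => (inner ℝ ξ v : ℝ)) u : ℝ) : ℂ)

theorem norm_compensatedChar_le (ξ u : EuclideanSpace ℝ (Fin d)) :
    ‖compensatedChar ξ u‖ ≤ (2 + 3 * ‖ξ‖ ^ 2) * min 1 (‖u‖ ^ 2) := by
  unfold compensatedChar
  by_cases hu : u ∈ Metric.closedBall (0 : EuclideanSpace ℝ (Fin d)) 1
  · rw [indicator_of_mem hu]
    have hu' : ‖u‖ ≤ 1 := mem_closedBall_zero_iff.1 hu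
    rw [min_eq_right (pow_le_one₀ (norm_nonneg _) hu')]
    refine (norm_exp_I_mul_ofReal_sub_one_sub_le _).trans ?_
    have h1 : (inner ℝ ξ u : ℝ) ^ 2 ≤ (‖ξ‖ * ‖u‖) ^ 2 :=
      sq_le_sq.2 (by
        rw [abs_of_nonneg (by positivity : 0 ≤ ‖ξ‖ * ‖u‖)]
        exact abs_real_inner_le_norm ξ u)
    nlinarith [sq_nonneg ‖u‖]
  · rw [indicator_of_notMem hu]
    have hu' : 1 ≤ ‖u‖ := by
      rw [mem_closedBall_zero_iff, not_le] at hu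
      exact hu.le
    rw [min_eq_left (one_le_pow₀ hu'), Complex.ofReal_zero, mul_zero, sub_zero, mul_one]
    have := norm_charIncrement_le_two ξ u
    unfold charIncrement at this
    nlinarith [sq_nonneg ‖ξ‖]

theorem IsLevyMeasure.integrable_compensatedChar (hν : IsLevyMeasure ν)
    (ξ : EuclideanSpace ℝ (Fin d)) : Integrable (compensatedChar ξ) ν := by
  refine (hν.integrable_min_one_norm_sq.const_mul (2 + 3 * ‖ξ‖ ^ 2)).mono' ?_
    (.of_forall fun u => norm_compensatedChar_le ξ u)
  have h1 : Measurable ((Metric.closedBall (0 : EuclideanSpace ℝ (Fin d)) 1).indicator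
      (fun v => (inner ℝ ξ v : ℝ))) :=
    Measurable.indicator (by fun_prop) Metric.isClosed_closedBall.measurableSet
  unfold compensatedChar
  exact Measurable.aestronglyMeasurable (by fun_prop)

/-- This is `ab - 1 = (a - 1)(b - 1) + (a - 1) + (b - 1)` with `a = e^{i⟨ξ;u⟩}` and `b =
e^{-i⟨η;u⟩}`. The compensator is additive in the frequency, so it splits between the last two terms
and leaves the product untouched. -/
theorem compensatedChar_sub (ξ η u : EuclideanSpace ℝ (Fin d)) :
    compensatedChar (ξ - η) u = charIncrement ξ u * conj (charIncrement η u)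
      + compensatedChar ξ u + conj (compensatedChar η u) := by
  unfold compensatedChar charIncrement
  have hexp : Complex.exp (Complex.I * ((inner ℝ (ξ - η) u : ℝ) : ℂ))
      = Complex.exp (Complex.I * ((inner ℝ ξ u : ℝ) : ℂ))
        * Complex.exp (-(Complex.I * ((inner ℝ η u : ℝ) : ℂ))) := by
    rw [← Complex.exp_add, inner_sub_left]
    push_cast
    ring_nf
  have hconj : conj (Complex.exp (Complex.I * ((inner ℝ η u : ℝ) : ℂ)))
      = Complex.exp (-(Complex.I * ((inner ℝ η u : ℝ) : ℂ))) := by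
    rw [← Complex.exp_conj]
    simp
  simp only [map_sub, map_mul, map_one, Complex.conj_I, Complex.conj_ofReal, hexp, hconj]
  by_cases hu : u ∈ Metric.closedBall (0 : EuclideanSpace ℝ (Fin d)) 1
  · simp only [indicator_of_mem hu, inner_sub_left]
    push_cast
    ring
  · simp only [indicator_of_notMem hu, Complex.ofReal_zero]
    ring

theorem IsLevyMeasure.levyExponent_sub (hν : IsLevyMeasure ν)
    (b ξ η : EuclideanSpace ℝ (Fin d)) :
    levyExponent b 0 ν (ξ - η)
      = levyExponent b 0 ν ξ + conj (levyExponent b 0 ν η) + levyGram ν ξ η := by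
  have hform : ∀ ζ, levyExponent b 0 ν ζ
      = Complex.I * ((inner ℝ b ζ : ℝ) : ℂ) + ∫ u, compensatedChar ζ u ∂ν := by
    intro ζ
    simp [levyExponent, compensatedChar]
  have hi := hν.integrable_compensatedChar
  have hc : Integrable (fun u => conj (compensatedChar η u)) ν :=
    Complex.conjCLE.toContinuousLinearMap.integrable_comp (hi η)
  have hg := integrable_charIncrement_mul_conj hν.integrable_min_one_norm_sq ξ η
  rw [hform, hform, hform]
  simp only [compensatedChar_sub]
  have hgc : Integrable (fun u => charIncrement ξ u * conj (charIncrement η u)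
      + compensatedChar ξ u) ν := hg.add (hi ξ)
  rw [integral_add hgc hc, integral_add hg (hi ξ), integral_conj, inner_sub_right, levyGram]
  simp only [map_add, map_mul, Complex.conj_I, Complex.conj_ofReal]
  push_cast
  ring

theorem IsInfinitelyDivisible.charFun_sub {μ : Measure (EuclideanSpace ℝ (Fin d))}
    {b : EuclideanSpace ℝ (Fin d)} (hμ : IsInfinitelyDivisible μ b 0 ν)
    (ξ η : EuclideanSpace ℝ (Fin d)) :
    charFun μ (ξ - η) = charFun μ ξ * conj (charFun μ η) * Complex.exp (levyGram ν ξ η) := by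
  rw [hμ.charFun_eq, hμ.charFun_eq, hμ.charFun_eq, hμ.isLevyMeasure.levyExponent_sub,
    Complex.exp_add, Complex.exp_add, Complex.exp_conj]

end LevyKhintchine

/-! ### Test functions as superpositions of characters. -/

section FourierRepresentation

open scoped FourierTransform SchwartzMap

variable {E : Type*} [NormedAddCommGroup E] [InnerProductSpace ℝ E] [FiniteDimensional ℝ E]
  [MeasurableSpace E] [BorelSpace E]

/-- A smooth compactly supported function is a superposition of characters with finite polynomial
moments. -/
theorem exists_hasPolyMoments_of_contDiff_of_hasCompactSupport {f : E → ℝ}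
    (hf : ContDiff ℝ ∞ f) (hfc : HasCompactSupport f) :
    ∃ (m : Measure E) (h : E → ℂ), SFinite m ∧ HasPolyMoments m h ∧
      ∀ x, (f x : ℂ) = ∫ ξ, h ξ * Complex.exp (((inner ℝ x ξ : ℝ) : ℂ) * Complex.I) ∂m := by
  let g : 𝓢(E, ℂ) := HasCompactSupport.toSchwartzMap (f := fun x => (f x : ℂ))
    (hfc.comp_left (g := fun r : ℝ => (r : ℂ)) Complex.ofReal_zero)
    (Complex.ofRealCLM.contDiff.comp hf)
  let F : 𝓢(E, ℂ) := 𝓕 g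
  have hπ : (2 * Real.pi) ≠ 0 := by positivity
  -- The Fourier transform is normalized with `e^{2πi⟨v;x⟩}`; pushing Lebesgue measure forward by
  -- `2π` gives characters `e^{i⟨x;ξ⟩}` with no Jacobian to track.
  let θ : E → E := fun v => (2 * Real.pi) • v
  have hθ : Measurable θ := measurable_const_smul _
  let h : E → ℂ := fun ξ => F ((2 * Real.pi)⁻¹ • ξ)
  have hθh : ∀ v, h (θ v) = F v := fun v => by
    simp only [h, θ, smul_smul, inv_mul_cancel₀ hπ, one_smul]
  have hh : Continuous h := F.continuous.comp (continuous_const_smul _)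
  refine ⟨volume.map θ, h, inferInstance, ⟨hh.measurable, fun N => ?_⟩, fun x => ?_⟩
  · rw [integrable_map_measure (by
      have := hh.measurable
      exact Measurable.aestronglyMeasurable (by fun_prop)) hθ.aemeasurable]
    -- The majorant comes from `(1 + a) ^ N ≤ 2 ^ (N - 1) * (1 + a ^ N)` with `a = 2π‖v‖`, followed
    -- by Schwartz decay.
    have hb := ((F.integrable_pow_mul volume 0).add
      ((F.integrable_pow_mul volume N).const_mul ((2 * Real.pi) ^ N))).const_mul (2 ^ (N - 1))
    refine hb.mono' ?_ (.of_forall fun v => ?_)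
    · have := hh.measurable
      exact Measurable.aestronglyMeasurable (by fun_prop)
    · simp only [Function.comp_apply, hθh]
      rw [Real.norm_of_nonneg (by positivity), norm_smul, Real.norm_of_nonneg (by positivity)]
      calc _ ≤ (2 ^ (N - 1) * (1 ^ N + (2 * Real.pi * ‖v‖) ^ N)) * ‖F v‖ := by
            gcongr
            exact add_pow_le zero_le_one (by positivity) N
        _ = _ := by
            simp only [Pi.add_apply, one_pow, pow_zero, mul_pow]
            ring
  · rw [integral_map hθ.aemeasurable (by
      have := hh.measurable
      exact Measurable.aestronglyMeasurable (by fun_prop))]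
    have hinv : 𝓕⁻ F = g := FourierTransform.fourierInv_fourier_eq g
    have hx : (f x : ℂ) = 𝓕⁻ (F : E → ℂ) x := by
      rw [← SchwartzMap.fourierInv_coe, hinv]
      rfl
    rw [hx, Real.fourierInv_eq']
    refine integral_congr_ae (.of_forall fun v => ?_)
    simp only [hθh, θ, smul_eq_mul]
    rw [inner_smul_right, real_inner_comm, mul_comm]

end FourierRepresentation

/-! ### The Poincaré inequality for the law of `X`. -/

theorem mainTheorem7 {Ω : Type*} [MeasurableSpace Ω] (P : Measure Ω) [IsProbabilityMeasure P]
    {d : ℕ} (X : Ω → EuclideanSpace ℝ (Fin d)) (hX : Measurable X)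
    (b : EuclideanSpace ℝ (Fin d)) (ν : Measure (EuclideanSpace ℝ (Fin d)))
    (hSD : IsSelfDecomposable (P.map X) b ν) (hcent : IsCentered X P)
    (hmom : IntegrableOn (fun u => ‖u‖) {u : EuclideanSpace ℝ (Fin d) | 1 ≤ ‖u‖} ν)
    (σ : Measure (Metric.sphere (0 : EuclideanSpace ℝ (Fin d)) 1)) [IsFiniteMeasure σ]
    (k : Metric.sphere (0 : EuclideanSpace ℝ (Fin d)) 1 → ℝ → ℝ)
    (hν : ν = polarMeasure σ k)
    (hk_nonneg : ∀ x, ∀ r ∈ Ioi (0 : ℝ), 0 ≤ k x r)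
    (hk_anti : ∀ x, AntitoneOn (k x) (Ioi 0))
    (hk_cont_r : ∀ x, ContinuousOn (k x) (Ioi 0))
    (hk_cont_x : ∀ r ∈ Ioi (0 : ℝ), Continuous (fun x => k x r))
    (hk_top : ∀ x, Tendsto (k x) atTop (𝓝 0))
    (hk_zero : ∀ x, Tendsto (fun r => r ^ 2 * k x r) (𝓝[>] 0) (𝓝 0))
    (f : EuclideanSpace ℝ (Fin d) → ℝ) (hf : ContDiff ℝ ∞ f) (hfc : HasCompactSupport f)
    (hf0 : ∫ w, f (X w) ∂P = 0) :
    (∀ x, Integrable (fun u => (f (x + u) - f x) ^ 2) ν) ∧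
    Integrable (fun w => ∫ u, (f (X w + u) - f (X w)) ^ 2 ∂ν) P ∧
    ∫ w, f (X w) ^ 2 ∂P ≤ ∫ w, ∫ u, (f (X w + u) - f (X w)) ^ 2 ∂ν ∂P := by
  have hID := hSD.isInfinitelyDivisible
  have hw := hID.isLevyMeasure.integrable_min_one_norm_sq
  have hprob := hID.isProbabilityMeasure
  -- The polar form exhibits `ν` as the image of an s-finite measure with density, which is what
  -- Fubini requires.
  have hsf : SFinite ν := by
    rw [hν, polarMeasure]
    infer_instance
  obtain ⟨m, h, hm, hh, hfh⟩ := exists_hasPolyMoments_of_contDiff_of_hasCompactSupport hf hfc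
  have hfm : Measurable f := hf.continuous.measurable
  have hint := (hh.integrable_prod_sub_sq (μ := P.map X) hfm hw hfh).integral_prod_left
  have hf0' : ∫ x, f x ∂(P.map X) = 0 := by
    rwa [integral_map hX.aemeasurable hfm.aestronglyMeasurable]
  have hmain := hh.integral_sq_le hfm hw hID.charFun_sub hfh hf0'
  refine ⟨hh.integrable_sub_sq hfm hw hfh, hint.comp_measurable hX, ?_⟩
  rwa [integral_map hX.aemeasurable (hfm.pow_const 2).aestronglyMeasurable,
    integral_map hX.aemeasurable hint.aestronglyMeasurable] at hmain
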